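/- A quandle is a set $X$ with a binary operation $*$ such that $x*x=x$, every map $x\mapsto x*y$ is a bijection (with inverse $x\mapsto x\,\bar*\,y$), and $(x*y)*z=(x*z)*(y*z)$. An oriented singquandle $(X,*,R_1,R_2)$ is a quandle with two maps $R_1,R_2:X\times X\to X$ such that for all $x,y,z\in X$ $$R_1(x\,\bar*\,y,z)*y=R_1(x,z*y),\qquad R_2(x\,\bar*\,y,z)=R_2(x,z*y)\,\bar*\,y,$$ $$(y\,\bar*\,R_1(x,z))*x=(y*R_2(x,z))\,\bar*\,z,$$ $$R_2(x,y)=R_1(y,x*y),\qquad R_1(x,y)*R_2(x,y)=R_2(y,x*y).$$ Let $D$ be a diagram of an oriented singular link, that is, an oriented planar 4-valent graph (possibly with closed circles without vertices) each of whose vertices is a positive, a negative or a singular crossing; its edges and its circles without vertices are the semiarcs of $D$. Draw each crossing with both strands running downwards. A coloring of $D$ by $X$ is a map from the semiarcs of $D$ to $X$ such that at every crossing, if the upper left and upper right semiarcs have the colors $x$ and $y$, then the lower left and lower right semiarcs have, respectively, the colors * $y$ and $x*y$ at a positive crossing (the over-strand runs from upper right to lower left), * $y\,\bar*\,x$ and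 $x$ at a negative crossing (the over-strand runs from upper left to lower right), * $R_1(x,y)$ and $R_2(x,y)$ at a singular crossing. Let $\mathrm{Col}_X(D)$ be the set of colorings of $D$ by $X$. **Lemma.** Let $(X,*,R_1,R_2)$ be an oriented singquandle. 1. If the diagram $D'$ arises from the diagram $D$ by an oriented singular Reidemeister move (any oriented version of $\Omega1$, $\Omega2$, $\Omega3$, of $\Omega4$, which slides a strand over or under a singular crossing, or of $\Omega5$, which moves a classical crossing from one side of a singular crossing to the other), then there is a bijection $\mathrm{Col}_X(D)\to\mathrm{Col}_X(D')$ under which corresponding colorings agree on all parts of semiarcs outside the disk in which the move takes place. 2. Consequently, if $D$ and $D'$ are connected by a finite sequence of such moves and their inverses (and isomorphisms of diagrams), then there is a bijection $\mathrm{Col}_X(D)\cong\mathrm{Col}_X(D')$. Thus the set of colorings is, up to bijection, an invariant of oriented singular knots and links. -/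

import Mathlib

namespace SingularLink

/-! ### Quandles and oriented singquandles -/

/-- The quandle product `x ∗ y`, in which `y` acts on `x` from the right. Mathlib writes the same
quandle with the action on the left, as `y ◃ x`. -/
def qop {X : Type*} [Quandle X] (x y : X) : X := Shelf.act y x

/-- The inverse operation: `(x ∗ y) ⊛ y = x = (x ⊛ y) ∗ y`. -/
def qinv {X : Type*} [Quandle X] (x y : X) : X := Rack.invAct y x

infixl:70 " ∗ " => SingularLink.qop
infixl:70 " ⊛ " => SingularLink.qinv

/-- The structure of an oriented singquandle `(X, ∗, R₁, R₂)` on a quandle `(X, ∗)`. -/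
structure OrientedSingquandle (X : Type*) [Quandle X] where
  R₁ : X → X → X
  R₂ : X → X → X
  r₁_slide : ∀ x y z, R₁ (x ⊛ y) z ∗ y = R₁ x (z ∗ y)
  r₂_slide : ∀ x y z, R₂ (x ⊛ y) z = R₂ x (z ∗ y) ⊛ y
  pass_under : ∀ x y z, (y ⊛ R₁ x z) ∗ x = (y ∗ R₂ x z) ⊛ z
  twist₁ : ∀ x y, R₂ x y = R₁ y (x ∗ y)
  twist₂ : ∀ x y, R₁ x y ∗ R₂ x y = R₂ y (x ∗ y)

/-! ### Diagrams with endpoints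

Every crossing is drawn with both strands running down the page. Its two incoming semiarcs are
then the upper left and the upper right one, its two outgoing semiarcs are the lower left and the
lower right one, and each strand runs from one side to the other side. -/

inductive Side
  | left
  | right

def Side.other : Side → Side
  | .left => .right
  | .right => .left

/-- In the downward picture of a classical crossing, the over-strand runs from upper right to lower
left if the crossing is positive, and from upper left to lower right if it is negative. -/
inductive CrossingKind
  | positive
  | negative
  | singular

/-- The two kinds of classical crossings. -/
def CrossingKind.ofSign : Bool → CrossingKind
  | true => .positive
  | false => .negative

/-- An oriented singular tangle diagram, seen as an oriented 4-valent graph with a rotation system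
(given by the sides at the crossings), whose open ends are the inputs `I` and the outputs `O`.
* `tail (inl i)` is the semiarc that starts at the input `i`;
* `tail (inr (v, s))` is the semiarc that leaves the crossing `v` on the lower side `s`;
* `head (inl o)` is the semiarc that ends at the output `o`;
* `head (inr (v, s))` is the semiarc that enters the crossing `v` on the upper side `s`.
A semiarc with neither a tail nor a head is a closed circle without crossings. -/
structure Tangle (I O : Type) where
  Arc : Type
  Crossing : Type
  finite_arc : Finite Arc
  finite_crossing : Finite Crossing
  kind : Crossing → CrossingKind
  tail : I ⊕ (Crossing × Side) → Arc
  head : O ⊕ (Crossing × Side) → Arc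
  tail_injective : Function.Injective tail
  head_injective : Function.Injective head
  range_tail_eq : Set.range tail = Set.range head

namespace Tangle

variable {I O : Type}

/-- The semiarc that enters the crossing `v` on the upper side `s`. -/
def inArc (T : Tangle I O) (v : T.Crossing) (s : Side) : T.Arc := T.head (.inr (v, s))

/-- The semiarc that leaves the crossing `v` on the lower side `s`. -/
def outArc (T : Tangle I O) (v : T.Crossing) (s : Side) : T.Arc := T.tail (.inr (v, s))

/-- The coloring condition at a crossing, for the colors `x`, `y` of the upper left and upper right
semiarc and the colors `z`, `w` of the lower left and lower right semiarc. -/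
def CrossingRule {X : Type*} [Quandle X] (Q : OrientedSingquandle X) :
    CrossingKind → X → X → X → X → Prop
  | .positive, x, y, z, w => z = y ∧ w = x ∗ y
  | .negative, x, y, z, w => z = y ⊛ x ∧ w = x
  | .singular, x, y, z, w => z = Q.R₁ x y ∧ w = Q.R₂ x y

/-- The set of colorings of a diagram by an oriented singquandle. -/
def Col {X : Type*} [Quandle X] (Q : OrientedSingquandle X) (T : Tangle I O) :
    Set (T.Arc → X) :=
  {c | ∀ v, CrossingRule Q (T.kind v) (c (T.inArc v .left)) (c (T.inArc v .right))
    (c (T.outArc v .left)) (c (T.outArc v .right))}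

/-! ### Planarity -/

/-- Two semiarcs that meet at a crossing. -/
def ArcAdj (T : Tangle I O) (a b : T.Arc) : Prop :=
  ∃ v, (∃ s, a = T.inArc v s ∨ a = T.outArc v s) ∧ (∃ s, b = T.inArc v s ∨ b = T.outArc v s)

/-- The connected components of the diagram as a graph (circles without crossings included). -/
def Component (T : Tangle I O) : Type := Quot T.ArcAdj

/-- `(a, s)` stands for the side `s` of the semiarc `a`, drawn downwards. At a crossing, the two
semiarc sides that bound the same one of its four corners (top, bottom, left, right) are adjacent
along the boundary of a face. -/
inductive CornerAdj (T : Tangle I O) : T.Arc × Side → T.Arc × Side → Prop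
  | top (v) : CornerAdj T (T.inArc v .left, .right) (T.inArc v .right, .left)
  | bottom (v) : CornerAdj T (T.outArc v .left, .right) (T.outArc v .right, .left)
  | left (v) : CornerAdj T (T.inArc v .left, .left) (T.outArc v .left, .left)
  | right (v) : CornerAdj T (T.inArc v .right, .right) (T.outArc v .right, .right)

/-- The faces of the diagram, each component being counted by itself. -/
def Face (T : Tangle I O) : Type := Quot T.CornerAdj

end Tangle

/-- An oriented singular link diagram: a diagram without endpoints that can be drawn on the sphere.
A 4-valent graph with `n` crossings has `2 * n` edges, so this is Euler's formula
`n - 2 * n + #faces = 2 * #components`; a circle without crossings has two faces. -/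
structure Diagram extends Tangle Empty Empty where
  euler : Nat.card toTangle.Face = Nat.card Crossing + 2 * Nat.card toTangle.Component

/-! ### Gluing a tangle into the rest of a diagram -/

/-- The tangle `T` lies in a disk and `S` outside it; the outputs of `T` are the inputs of `S`
and conversely. These are the identifications of semiarcs at the boundary of the disk. -/
inductive GlueRel {I O : Type} (T : Tangle I O) (S : Tangle O I) :
    T.Arc ⊕ S.Arc → T.Arc ⊕ S.Arc → Prop
  | outward (o : O) : GlueRel T S (.inl (T.head (.inl o))) (.inr (S.tail (.inl o)))
  | inward (i : I) : GlueRel T S (.inr (S.head (.inl i))) (.inl (T.tail (.inl i)))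

/-- A presentation of the closed diagram `D` as the result of gluing `T` and `S`. The map `arc`
sends each piece of a semiarc to the semiarc of `D` that contains it. -/
structure Gluing {I O : Type} (T : Tangle I O) (S : Tangle O I) (D : Tangle Empty Empty) where
  crossing : T.Crossing ⊕ S.Crossing ≃ D.Crossing
  arc : T.Arc ⊕ S.Arc → D.Arc
  arc_surjective : Function.Surjective arc
  arc_eq_iff : ∀ a b, arc a = arc b ↔ Relation.EqvGen (GlueRel T S) a b
  kind_inl : ∀ v, D.kind (crossing (.inl v)) = T.kind v
  kind_inr : ∀ v, D.kind (crossing (.inr v)) = S.kind v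
  inArc_inl : ∀ v s, D.inArc (crossing (.inl v)) s = arc (.inl (T.inArc v s))
  inArc_inr : ∀ v s, D.inArc (crossing (.inr v)) s = arc (.inr (S.inArc v s))
  outArc_inl : ∀ v s, D.outArc (crossing (.inl v)) s = arc (.inl (T.outArc v s))
  outArc_inr : ∀ v s, D.outArc (crossing (.inr v)) s = arc (.inr (S.outArc v s))

/-- Two codes of the same diagram. -/
structure Iso (D D' : Diagram) where
  crossing : D.Crossing ≃ D'.Crossing
  arc : D.Arc ≃ D'.Arc
  kind_eq : ∀ v, D'.kind (crossing v) = D.kind v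
  inArc_eq : ∀ v s, D'.inArc (crossing v) s = arc (D.inArc v s)
  outArc_eq : ∀ v s, D'.outArc (crossing v) s = arc (D.outArc v s)

/-! ### The local pictures in the Reidemeister moves -/

/-- The tangle given by the table `next`, which says for every start of a semiarc (an input, or the
lower side `s` of a crossing) where it ends (an output, or the upper side of a crossing). -/
def Tangle.ofNext {I O V : Type} [Finite I] [Finite V] (kind : V → CrossingKind)
    (next : I ⊕ (V × Side) ≃ O ⊕ (V × Side)) : Tangle I O where
  Arc := I ⊕ (V × Side)
  Crossing := V
  finite_arc := by
    have : Finite Side := Finite.of_injective (fun s : Side => (Side.casesOn s true false : Bool))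
      (by rintro (_ | _) (_ | _) <;> simp)
    infer_instance
  finite_crossing := inferInstance
  kind := kind
  tail := id
  head := next.symm
  tail_injective := Function.injective_id
  head_injective := next.symm.injective
  range_tail_eq := by rw [Set.range_id, next.symm.surjective.range_eq]

/-- In all pictures below with `n` strands, the inputs and the outputs are numbered by strands. -/
abbrev LocalTangle (n : ℕ) : Type 1 := Tangle (Fin n) (Fin n)

/-- `n` strands that do not meet. -/
def strands (n : ℕ) : LocalTangle n :=
  Tangle.ofNext (V := Empty) (fun v => v.elim)
    { toFun := fun | .inl i => .inl i
      invFun := fun | .inl i => .inl i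
      left_inv := by rintro (i | ⟨⟨⟩, _⟩); rfl
      right_inv := by rintro (i | ⟨⟨⟩, _⟩); rfl }

/-- One strand with a curl: the semiarc that leaves the crossing on the side `s` enters it again on
the same side. -/
def curl (s : Side) (k : CrossingKind) : LocalTangle 1 :=
  Tangle.ofNext (V := Unit) (fun _ => k)
    { toFun := fun
        | .inl _ => .inr ((), s.other)
        | .inr ((), t) => match s, t with
          | .left, .left => .inr ((), .left)
          | .left, .right => .inl 0
          | .right, .right => .inr ((), .right)
          | .right, .left => .inl 0
      invFun := fun
        | .inl _ => .inr ((), s.other)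
        | .inr ((), t) => match s, t with
          | .left, .left => .inr ((), .left)
          | .left, .right => .inl 0
          | .right, .right => .inr ((), .right)
          | .right, .left => .inl 0
      left_inv := by
        cases s <;> rintro (i | ⟨⟨⟩, _ | _⟩) <;> simp [Side.other, Fin.fin_one_eq_zero]
      right_inv := by
        cases s <;> rintro (i | ⟨⟨⟩, _ | _⟩) <;> simp [Side.other, Fin.fin_one_eq_zero] }

/-- The orientations of a bigon formed by two strands: both strands run from the first crossing to
the second one, or the bigon is an oriented cycle (clockwise or counterclockwise). -/
inductive BigonShape
  | parallel
  | clockwise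
  | counterclockwise

/-- Where the semiarcs of a bigon with the crossings `0` and `1` end. -/
def bigonNext : BigonShape → (Fin 2 ⊕ (Fin 2 × Side) ≃ Fin 2 ⊕ (Fin 2 × Side))
  | .parallel =>
    { toFun := fun
        | .inl 0 => .inr (0, .left)
        | .inl 1 => .inr (0, .right)
        | .inr (0, .left) => .inr (1, .left)
        | .inr (0, .right) => .inr (1, .right)
        | .inr (1, .left) => .inl 0
        | .inr (1, .right) => .inl 1
      invFun := fun
        | .inr (0, .left) => .inl 0
        | .inr (0, .right) => .inl 1
        | .inr (1, .left) => .inr (0, .left)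
        | .inr (1, .right) => .inr (0, .right)
        | .inl 0 => .inr (1, .left)
        | .inl 1 => .inr (1, .right)
      left_inv := by rintro (i | ⟨i, _ | _⟩) <;> fin_cases i <;> rfl
      right_inv := by rintro (i | ⟨i, _ | _⟩) <;> fin_cases i <;> rfl }
  | .clockwise =>
    { toFun := fun
        | .inl 0 => .inr (0, .right)
        | .inr (0, .left) => .inr (1, .left)
        | .inr (1, .right) => .inl 0
        | .inl 1 => .inr (1, .right)
        | .inr (1, .left) => .inr (0, .left)
        | .inr (0, .right) => .inl 1
      invFun := fun
        | .inr (0, .right) => .inl 0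
        | .inr (1, .left) => .inr (0, .left)
        | .inl 0 => .inr (1, .right)
        | .inr (1, .right) => .inl 1
        | .inr (0, .left) => .inr (1, .left)
        | .inl 1 => .inr (0, .right)
      left_inv := by rintro (i | ⟨i, _ | _⟩) <;> fin_cases i <;> rfl
      right_inv := by rintro (i | ⟨i, _ | _⟩) <;> fin_cases i <;> rfl }
  | .counterclockwise =>
    { toFun := fun
        | .inl 0 => .inr (0, .left)
        | .inr (0, .right) => .inr (1, .right)
        | .inr (1, .left) => .inl 0
        | .inl 1 => .inr (1, .left)
        | .inr (1, .right) => .inr (0, .right)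
        | .inr (0, .left) => .inl 1
      invFun := fun
        | .inr (0, .left) => .inl 0
        | .inr (1, .right) => .inr (0, .right)
        | .inl 0 => .inr (1, .left)
        | .inr (1, .left) => .inl 1
        | .inr (0, .right) => .inr (1, .right)
        | .inl 1 => .inr (0, .left)
      left_inv := by rintro (i | ⟨i, _ | _⟩) <;> fin_cases i <;> rfl
      right_inv := by rintro (i | ⟨i, _ | _⟩) <;> fin_cases i <;> rfl }

/-- Two strands that form a bigon, with crossings of the kinds `k₀` and `k₁`. -/
def bigon (σ : BigonShape) (k₀ k₁ : CrossingKind) : LocalTangle 2 :=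
  Tangle.ofNext (V := Fin 2) ![k₀, k₁] (bigonNext σ)

/-- The kind of the crossing of two strands at the heights `a` (entering on the left) and `b`
(entering on the right): equal heights mean that the strands meet in a singular point. -/
def CrossingKind.ofHeights (a b : ℕ) : CrossingKind :=
  if a = b then .singular else if a < b then .positive else .negative

/-- The orientations of three pairwise crossing strands up to rotation: all of them run down the
page, or inputs and outputs alternate around the disk (the strands point up, to the lower left and
to the lower right). -/
inductive TriangleShape
  | braided
  | alternating

/-- Crossing `0` joins the strands 0 and 1, crossing `1` the strands 1 and 2, and crossing `2` the
strands 2 and 0. In the braided case the strand with the smaller number enters on the left, in the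
alternating case strand `k` enters crossing `k` on the right and crossing `k - 1` on the left. -/
def triangleKind (h : Fin 3 → ℕ) : TriangleShape → Fin 3 → CrossingKind
  | .braided => ![.ofHeights (h 0) (h 1), .ofHeights (h 1) (h 2), .ofHeights (h 0) (h 2)]
  | .alternating => ![.ofHeights (h 1) (h 0), .ofHeights (h 2) (h 1), .ofHeights (h 0) (h 2)]

/-- The first of the two triangles. Braided: strand 0 first crosses strand 1 and then strand 2,
strand 1 meets 0 and then 2, and strand 2 meets 0 and then 1. Alternating: strand `k` meets strand
`k - 1` and then strand `k + 1`. -/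
def triangleNext : TriangleShape → (Fin 3 ⊕ (Fin 3 × Side) ≃ Fin 3 ⊕ (Fin 3 × Side))
  | .braided =>
    { toFun := fun
        | .inl 0 => .inr (0, .left)
        | .inr (0, .right) => .inr (2, .left)
        | .inr (2, .right) => .inl 0
        | .inl 1 => .inr (0, .right)
        | .inr (0, .left) => .inr (1, .left)
        | .inr (1, .right) => .inl 1
        | .inl 2 => .inr (2, .right)
        | .inr (2, .left) => .inr (1, .right)
        | .inr (1, .left) => .inl 2
      invFun := fun
        | .inr (0, .left) => .inl 0
        | .inr (2, .left) => .inr (0, .right)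
        | .inl 0 => .inr (2, .right)
        | .inr (0, .right) => .inl 1
        | .inr (1, .left) => .inr (0, .left)
        | .inl 1 => .inr (1, .right)
        | .inr (2, .right) => .inl 2
        | .inr (1, .right) => .inr (2, .left)
        | .inl 2 => .inr (1, .left)
      left_inv := by rintro (i | ⟨i, _ | _⟩) <;> fin_cases i <;> rfl
      right_inv := by rintro (i | ⟨i, _ | _⟩) <;> fin_cases i <;> rfl }
  | .alternating =>
    { toFun := fun
        | .inl k => .inr (k - 1, .left)
        | .inr (k, .right) => .inr (k + 1, .right)
        | .inr (k, .left) => .inl k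
      invFun := fun
        | .inr (k, .left) => .inl (k + 1)
        | .inr (k, .right) => .inr (k - 1, .right)
        | .inl k => .inr (k, .left)
      left_inv := by rintro (i | ⟨i, _ | _⟩) <;> simp
      right_inv := by rintro (i | ⟨i, _ | _⟩) <;> simp }

/-- The second of the two triangles: every strand meets the other two in the opposite order. -/
def triangleNext' : TriangleShape → (Fin 3 ⊕ (Fin 3 × Side) ≃ Fin 3 ⊕ (Fin 3 × Side))
  | .braided =>
    { toFun := fun
        | .inl 0 => .inr (2, .left)
        | .inr (2, .right) => .inr (0, .left)
        | .inr (0, .right) => .inl 0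
        | .inl 1 => .inr (1, .left)
        | .inr (1, .right) => .inr (0, .right)
        | .inr (0, .left) => .inl 1
        | .inl 2 => .inr (1, .right)
        | .inr (1, .left) => .inr (2, .right)
        | .inr (2, .left) => .inl 2
      invFun := fun
        | .inr (2, .left) => .inl 0
        | .inr (0, .left) => .inr (2, .right)
        | .inl 0 => .inr (0, .right)
        | .inr (1, .left) => .inl 1
        | .inr (0, .right) => .inr (1, .right)
        | .inl 1 => .inr (0, .left)
        | .inr (1, .right) => .inl 2
        | .inr (2, .right) => .inr (1, .left)
        | .inl 2 => .inr (2, .left)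
      left_inv := by rintro (i | ⟨i, _ | _⟩) <;> fin_cases i <;> rfl
      right_inv := by rintro (i | ⟨i, _ | _⟩) <;> fin_cases i <;> rfl }
  | .alternating =>
    { toFun := fun
        | .inl k => .inr (k, .right)
        | .inr (k, .left) => .inr (k - 1, .left)
        | .inr (k, .right) => .inl (k + 1)
      invFun := fun
        | .inr (k, .right) => .inl k
        | .inr (k, .left) => .inr (k + 1, .left)
        | .inl k => .inr (k - 1, .right)
      left_inv := by rintro (i | ⟨i, _ | _⟩) <;> simp
      right_inv := by rintro (i | ⟨i, _ | _⟩) <;> simp }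

/-- Three strands at the heights `h` that form the first triangle. -/
def triangle (σ : TriangleShape) (h : Fin 3 → ℕ) : LocalTangle 3 :=
  Tangle.ofNext (V := Fin 3) (triangleKind h σ) (triangleNext σ)

/-- Three strands at the heights `h` that form the second triangle. -/
def triangle' (σ : TriangleShape) (h : Fin 3 → ℕ) : LocalTangle 3 :=
  Tangle.ofNext (V := Fin 3) (triangleKind h σ) (triangleNext' σ)

/-! ### Reidemeister moves -/

/-- All oriented singular Reidemeister moves, as replacements of one picture in a disk by another.
Up to rotation these are 4 moves `Ω1`, 4 moves `Ω2`, 8 moves `Ω3`, 8 moves `Ω4` (a strand slides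
over or under a singular point) and 6 moves `Ω5` (a classical crossing next to a singular point
passes to its other side). -/
inductive LocalMove : {n : ℕ} → LocalTangle n → LocalTangle n → Prop
  | omega1 (s : Side) (ε : Bool) : LocalMove (strands 1) (curl s (.ofSign ε))
  | omega2 (σ : BigonShape) (ε : Bool) :
      LocalMove (strands 2) (bigon σ (.ofSign ε) (.ofSign !ε))
  | omega3 (σ : TriangleShape) (h : Fin 3 → ℕ) (hh : Function.Injective h) :
      LocalMove (triangle σ h) (triangle' σ h)
  | omega4 (σ : TriangleShape) (h : Fin 3 → ℕ) (i j k : Fin 3) (hij : i ≠ j) (heq : h i = h j)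
      (hne : h k ≠ h i) : LocalMove (triangle σ h) (triangle' σ h)
  | omega5 (σ : BigonShape) (ε : Bool) :
      LocalMove (bigon σ .singular (.ofSign ε)) (bigon σ (.ofSign ε) .singular)

/-- An oriented singular Reidemeister move from `D` to `D'`: inside a disk the picture `T` is
replaced by `T'`, and the picture `S` outside the disk stays the same. -/
structure Move (D D' : Diagram) where
  n : ℕ
  T : LocalTangle n
  T' : LocalTangle n
  S : LocalTangle n
  localMove : LocalMove T T'
  glue : Gluing T S D.toTangle
  glue' : Gluing T' S D'.toTangle

/-- Two oriented singular link diagrams represent the same oriented singular link if they are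
connected by finitely many oriented singular Reidemeister moves (in either direction). -/
def Equivalent : Diagram → Diagram → Prop :=
  Relation.EqvGen fun D D' => Nonempty (Iso D D') ∨ Nonempty (Move D D')

end SingularLink

/-! A coloring condition involves only the four semiarcs at one crossing, so a coloring of a glued
diagram is the same thing as a coloring of the tangle inside the disk and one of the tangle outside
that agree at the common endpoints. It therefore suffices to compare the two local pictures of a
move. They are interchangeable if each has at most one coloring with given endpoint colors and both
realize the same endpoint colors (`ColorEquivalent`). `Gluing.exists_equiv` turns this into a
bijection that fixes all colors outside the disk.

The local check is algebra in the colors of the inner semiarcs. Ω1 is idempotence, Ω2 the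
invertibility of right translations, Ω3 self-distributivity. Ω4 is `r₁_slide` and `r₂_slide` when
the third strand passes over the singular point, and `pass_under` when it passes under. Ω5 with
parallel strands is `twist₁` and `twist₂`. The delicate cases are two antiparallel versions of Ω5 in
which an inner color is given only implicitly; they are settled by `antiparallel_negative` and
`antiparallel_positive`, which combine all five axioms. -/

namespace SingularLink

/-! ### Quandle identities -/

section Quandle

variable {X : Type*} [Quandle X]

theorem qop_qinv (x y : X) : (x ∗ y) ⊛ y = x := Rack.left_inv y x

theorem qinv_qop (x y : X) : (x ⊛ y) ∗ y = x := Rack.right_inv y x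

theorem qop_self (x : X) : x ∗ x = x := Quandle.fix

theorem qinv_self (x : X) : x ⊛ x = x := Quandle.fix_inv

theorem eq_qinv_iff {x y z : X} : x = y ⊛ z ↔ x ∗ z = y :=
  ⟨fun h => by rw [h, qinv_qop], fun h => by rw [← h, qop_qinv]⟩

theorem qop_right_cancel {x y z : X} (h : x ∗ z = y ∗ z) : x = y := by
  rw [← qop_qinv x z, h, qop_qinv]

theorem qop_qop (x y z : X) : (x ∗ y) ∗ z = (x ∗ z) ∗ (y ∗ z) := Shelf.self_distrib

/-- Right translation by `z` and its inverse are quandle automorphisms, so they also respect the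
inverse operation. -/
theorem qinv_qop_distrib (x y z : X) : (x ⊛ y) ∗ z = (x ∗ z) ⊛ (y ∗ z) := by
  rw [eq_qinv_iff, ← qop_qop, qinv_qop]

theorem qop_qinv_distrib (x y z : X) : (x ∗ y) ⊛ z = (x ⊛ z) ∗ (y ⊛ z) := by
  rw [eq_comm, eq_qinv_iff, qop_qop, qinv_qop, qinv_qop]

theorem qinv_qinv_distrib (x y z : X) : (x ⊛ y) ⊛ z = (x ⊛ z) ⊛ (y ⊛ z) := by
  rw [eq_qinv_iff, ← qop_qinv_distrib, qinv_qop]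

end Quandle

/-! ### Colorings of tangles compared through their endpoints -/

namespace Tangle

variable {X : Type*} [Quandle X] {Q : OrientedSingquandle X} {I O : Type}

/-- Colorings of two tangles that agree at all endpoints. -/
def BoundaryEq {T T' : Tangle I O} (c : T.Arc → X) (c' : T'.Arc → X) : Prop :=
  (∀ i, c (T.tail (.inl i)) = c' (T'.tail (.inl i))) ∧
    ∀ o, c (T.head (.inl o)) = c' (T'.head (.inl o))

/-- A coloring is determined by its values at the endpoints. -/
def BoundaryDetermined (Q : OrientedSingquandle X) (T : Tangle I O) : Prop :=
  ∀ c ∈ T.Col Q, ∀ d ∈ T.Col Q, BoundaryEq c d → c = d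

/-- All boundary values of colorings of `T` are boundary values of colorings of `T'`. -/
def BoundaryLE (Q : OrientedSingquandle X) (T T' : Tangle I O) : Prop :=
  ∀ c ∈ T.Col Q, ∃ c' ∈ T'.Col Q, BoundaryEq c c'

/-- Colorings of `T` and `T'` correspond to each other through their boundary values. -/
structure ColorEquivalent (Q : OrientedSingquandle X) (T T' : Tangle I O) : Prop where
  determined : BoundaryDetermined Q T
  determined' : BoundaryDetermined Q T'
  le : BoundaryLE Q T T'
  ge : BoundaryLE Q T' T

end Tangle

/-! ### Colorings of a glued diagram -/

namespace Gluing

open Tangle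

variable {X : Type*} [Quandle X] {Q : OrientedSingquandle X} {I O : Type}
variable {T T' : Tangle I O} {S : Tangle O I} {D D' : Tangle Empty Empty}

theorem arc_outward (g : Gluing T S D) (o : O) :
    g.arc (.inl (T.head (.inl o))) = g.arc (.inr (S.tail (.inl o))) :=
  (g.arc_eq_iff _ _).2 (.rel _ _ (.outward o))

theorem arc_inward (g : Gluing T S D) (i : I) :
    g.arc (.inr (S.head (.inl i))) = g.arc (.inl (T.tail (.inl i))) :=
  (g.arc_eq_iff _ _).2 (.rel _ _ (.inward i))

/-- The crossings of `D` are the disjoint union of those of `T` and `S`, and the coloring condition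
is local at crossings. -/
theorem mem_col_iff (g : Gluing T S D) (c : D.Arc → X) :
    c ∈ D.Col Q ↔ (fun a => c (g.arc (.inl a))) ∈ T.Col Q ∧
      (fun a => c (g.arc (.inr a))) ∈ S.Col Q := by
  simp only [Col, Set.mem_ofPred_eq, ← g.crossing.forall_congr_right (q := fun v => CrossingRule Q
    (D.kind v) (c (D.inArc v .left)) (c (D.inArc v .right)) (c (D.outArc v .left))
    (c (D.outArc v .right))), Sum.forall, g.kind_inl, g.kind_inr, g.inArc_inl, g.inArc_inr,
    g.outArc_inl, g.outArc_inr]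

omit [Quandle X] in
theorem exists_color (g : Gluing T S D) (c : T.Arc → X) (d : S.Arc → X)
    (hi : ∀ i, d (S.head (.inl i)) = c (T.tail (.inl i)))
    (ho : ∀ o, c (T.head (.inl o)) = d (S.tail (.inl o))) :
    ∃ e : D.Arc → X, (∀ a, e (g.arc (.inl a)) = c a) ∧ ∀ a, e (g.arc (.inr a)) = d a := by
  -- The combined coloring is constant on the classes of the gluing relation, hence descends to the
  -- semiarcs of `D`; the choice of representatives below is then immaterial.
  have key : ∀ a b, g.arc a = g.arc b → Sum.elim c d a = Sum.elim c d b := by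
    intro a b hab
    induction (g.arc_eq_iff a b).1 hab with
    | rel _ _ h => cases h with
      | outward o => exact ho o
      | inward i => exact hi i
    | refl _ => rfl
    | symm _ _ h ih => exact (ih ((g.arc_eq_iff _ _).2 h)).symm
    | trans _ _ _ h h' ih ih' =>
      exact (ih ((g.arc_eq_iff _ _).2 h)).trans (ih' ((g.arc_eq_iff _ _).2 h'))
  refine ⟨fun a => Sum.elim c d (g.arc_surjective a).choose, fun a => ?_, fun a => ?_⟩
  · exact key _ (.inl a) (g.arc_surjective _).choose_spec
  · exact key _ (.inr a) (g.arc_surjective _).choose_spec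

/-- A coloring of the whole diagram is determined by the part outside the disk. -/
theorem col_ext (g : Gluing T S D) (hT : BoundaryDetermined Q T) {c d : D.Arc → X}
    (hc : c ∈ D.Col Q) (hd : d ∈ D.Col Q)
    (h : ∀ a, c (g.arc (.inr a)) = d (g.arc (.inr a))) : c = d := by
  have key := hT _ ((g.mem_col_iff c).1 hc).1 _ ((g.mem_col_iff d).1 hd).1
    ⟨fun i => by simp only [← g.arc_inward, h], fun o => by simp only [g.arc_outward, h]⟩
  funext a
  obtain ⟨a | a, rfl⟩ := g.arc_surjective a
  · exact congrFun key a
  · exact h a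

theorem exists_col (g : Gluing T S D) (g' : Gluing T' S D') (hT : BoundaryLE Q T T')
    {c : D.Arc → X} (hc : c ∈ D.Col Q) :
    ∃ c' ∈ D'.Col Q, ∀ a, c' (g'.arc (.inr a)) = c (g.arc (.inr a)) := by
  obtain ⟨hcT, hcS⟩ := (g.mem_col_iff c).1 hc
  obtain ⟨d, hd, hi, ho⟩ := hT _ hcT
  obtain ⟨e, heT, heS⟩ := g'.exists_color d (fun a => c (g.arc (.inr a)))
    (fun i => by rw [← hi,
      g.arc_inward]) (fun o => by rw [← ho]; exact congrArg c (g.arc_outward o))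
  exact ⟨e, (g'.mem_col_iff e).2 ⟨by simpa only [heT] using hd, by simpa only [heS] using hcS⟩, heS⟩

/-- Replacing a tangle by a color equivalent one does not change the set of colorings. -/
theorem exists_equiv (g : Gluing T S D) (g' : Gluing T' S D') (hT : ColorEquivalent Q T T') :
    ∃ Φ : D.Col Q ≃ D'.Col Q, ∀ (c : D.Col Q) (a : S.Arc),
      (Φ c).1 (g'.arc (.inr a)) = c.1 (g.arc (.inr a)) := by
  choose f hf hfS using fun c : D.Col Q => g.exists_col g' hT.le c.2
  choose f' hf' hfS' using fun c : D'.Col Q => g'.exists_col g hT.ge c.2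
  refine ⟨⟨fun c => ⟨f c, hf c⟩, fun c => ⟨f' c, hf' c⟩, fun c => Subtype.ext ?_,
    fun c => Subtype.ext ?_⟩, hfS⟩
  -- Both composites keep the colors outside the disk, and these determine the whole coloring.
  · exact g.col_ext hT.determined (hf' _) c.2 fun a => (hfS' _ a).trans (hfS c a)
  · exact g'.col_ext hT.determined' (hf _) c.2 fun a => (hfS _ a).trans (hfS' c a)

end Gluing

theorem Iso.nonempty_col_equiv {X : Type*} [Quandle X] (Q : OrientedSingquandle X)
    {D D' : Diagram} (e : Iso D D') : Nonempty (D.Col Q ≃ D'.Col Q) := by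
  refine ⟨(e.arc.arrowCongr (Equiv.refl X)).subtypeEquiv fun c => ?_⟩
  change (∀ v, _) ↔ ∀ v, _
  rw [← e.crossing.forall_congr_right]
  simp [e.kind_eq, e.inArc_eq, e.outArc_eq]

/-! ### Coloring equations of the local pictures -/

section LocalMoves

open Tangle

variable {X : Type*} [Quandle X] {Q : OrientedSingquandle X}

/-- `T` has a coloring with the values `a` at the inputs and `b` at the outputs. -/
def Tangle.HasColoring {I O : Type} (Q : OrientedSingquandle X) (T : Tangle I O) (a : I → X)
    (b : O → X) : Prop :=
  ∃ c ∈ T.Col Q, (∀ i, c (T.tail (.inl i)) = a i) ∧ ∀ o, c (T.head (.inl o)) = b o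

theorem Tangle.BoundaryLE.of_hasColoring {I O : Type} {T T' : Tangle I O}
    (h : ∀ a b, T.HasColoring Q a b → T'.HasColoring Q a b) : BoundaryLE Q T T' := by
  intro c hc
  obtain ⟨d, hd, hi, ho⟩ := h _ _ ⟨c, hc, fun _ => rfl, fun _ => rfl⟩
  exact ⟨d, hd, fun i => (hi i).symm, fun o => (ho o).symm⟩

theorem Tangle.ColorEquivalent.of_hasColoring_iff {I O : Type} {T T' : Tangle I O}
    (hT : BoundaryDetermined Q T) (hT' : BoundaryDetermined Q T')
    (h : ∀ a b, T.HasColoring Q a b ↔ T'.HasColoring Q a b) : ColorEquivalent Q T T' :=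
  ⟨hT, hT', .of_hasColoring fun a b => (h a b).1, .of_hasColoring fun a b => (h a b).2⟩

/-- The coloring of a tangle `Tangle.ofNext kind next` with the colors `a` at the inputs and the
colors `l`, `r` at the lower left and lower right semiarcs of the crossings. -/
def colorOf {I V : Type} (a : I → X) (l r : V → X) : I ⊕ (V × Side) → X
  | .inl i => a i
  | .inr (v, .left) => l v
  | .inr (v, .right) => r v

theorem hasColoring_strands {n : ℕ} {a b : Fin n → X} :
    (strands n).HasColoring Q a b ↔ a = b := by
  constructor
  · rintro ⟨c, -, ha, hb⟩
    funext i
    exact (ha i).symm.trans (hb i)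
  · rintro rfl
    exact ⟨Sum.elim a fun v => v.1.elim, fun v => v.elim, fun _ => rfl, fun _ => rfl⟩

theorem boundaryDetermined_strands (n : ℕ) : BoundaryDetermined Q (strands n) := by
  intro c _ d _ h
  funext a
  rcases a with i | ⟨⟨⟩, _⟩
  exact h.1 i

theorem mem_col_curl_left {k : CrossingKind} {c : Fin 1 ⊕ (Unit × Side) → X} :
    c ∈ (curl .left k).Col Q ↔ CrossingRule Q k (c (.inr ((), .left))) (c (.inl 0))
      (c (.inr ((), .left))) (c (.inr ((), .right))) :=
  ⟨fun h => h (), fun h _ => h⟩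

theorem mem_col_curl_right {k : CrossingKind} {c : Fin 1 ⊕ (Unit × Side) → X} :
    c ∈ (curl .right k).Col Q ↔ CrossingRule Q k (c (.inl 0)) (c (.inr ((), .right)))
      (c (.inr ((), .left))) (c (.inr ((), .right))) :=
  ⟨fun h => h (), fun h _ => h⟩

/-- Either the curl equates two colors outright, or it gives an equation such as `x ∗ y = y`. The
latter forces `x = y`, because `y ∗ y = y` and right translation by `y` is injective. -/
theorem mem_col_curl_iff {s : Side} {ε : Bool} {c : Fin 1 ⊕ (Unit × Side) → X} :
    c ∈ (curl s (.ofSign ε)).Col Q ↔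
      c (.inr ((), .left)) = c (.inl 0) ∧ c (.inr ((), .right)) = c (.inl 0) := by
  have h (x y : X) : x ∗ y = y ↔ x = y :=
    ⟨fun h => qop_right_cancel (h.trans (qop_self y).symm), fun h => by rw [h, qop_self]⟩
  cases s
  · refine mem_col_curl_left.trans ?_
    cases ε <;> simp only [CrossingRule, CrossingKind.ofSign, eq_qinv_iff] <;>
      grind [qop_self]
  · refine mem_col_curl_right.trans ?_
    cases ε <;> simp only [CrossingRule, CrossingKind.ofSign, eq_qinv_iff] <;>
      grind [qop_self]

theorem colorEquivalent_curl (s : Side) (ε : Bool) :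
    ColorEquivalent Q (strands 1) (curl s (.ofSign ε)) := by
  refine .of_hasColoring_iff (boundaryDetermined_strands 1) (fun c hc d hd h => ?_) fun a b => ?_
  · have h0 : c (.inl 0) = d (.inl 0) := h.1 0
    have hc := mem_col_curl_iff.1 hc
    have hd := mem_col_curl_iff.1 hd
    funext a
    rcases a with i | ⟨⟨⟩, _ | _⟩
    · exact h.1 i
    · exact hc.1.trans (h0.trans hd.1.symm)
    · exact hc.2.trans (h0.trans hd.2.symm)
  · rw [hasColoring_strands]
    constructor
    · rintro rfl
      refine ⟨fun _ => a 0, mem_col_curl_iff.2 ⟨rfl, rfl⟩, fun i => ?_, fun i => ?_⟩ <;>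
        rw [Fin.fin_one_eq_zero i]
    · rintro ⟨c, hc, ha, hb⟩
      have hc := mem_col_curl_iff.1 hc
      funext i
      rw [Fin.fin_one_eq_zero i, ← ha, ← hb]
      -- The outgoing end leaves the crossing on the side opposite to the loop.
      cases s
      · exact hc.2.symm
      · exact hc.1.symm

theorem funext_two {Y : Type*} {c d : Fin 2 ⊕ (Fin 2 × Side) → Y} (h : ∀ i, c (.inl i) = d (.inl i))
    (h₀ : c (.inr (0, .left)) = d (.inr (0, .left)) ∧ c (.inr (0, .right)) = d (.inr (0, .right)))
    (h₁ : c (.inr (1, .left)) = d (.inr (1, .left)) ∧ c (.inr (1, .right)) = d (.inr (1, .right))) :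
    c = d := by
  funext a
  rcases a with i | ⟨i, _ | _⟩
  · exact h i
  · fin_cases i; exacts [h₀.1, h₁.1]
  · fin_cases i; exacts [h₀.2, h₁.2]

theorem funext_three {Y : Type*} {c d : Fin 3 ⊕ (Fin 3 × Side) → Y}
    (h : ∀ i, c (.inl i) = d (.inl i))
    (h₀ : c (.inr (0, .left)) = d (.inr (0, .left)) ∧ c (.inr (0, .right)) = d (.inr (0, .right)))
    (h₁ : c (.inr (1, .left)) = d (.inr (1, .left)) ∧ c (.inr (1, .right)) = d (.inr (1, .right)))
    (h₂ : c (.inr (2, .left)) = d (.inr (2, .left)) ∧ c (.inr (2, .right)) = d (.inr (2, .right))) :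
    c = d := by
  funext a
  rcases a with i | ⟨i, _ | _⟩
  · exact h i
  · fin_cases i; exacts [h₀.1, h₁.1, h₂.1]
  · fin_cases i; exacts [h₀.2, h₁.2, h₂.2]

theorem forall_fin_three {P : Fin 3 → Prop} : (∀ i, P i) ↔ P 0 ∧ P 1 ∧ P 2 :=
  ⟨fun h => ⟨h 0, h 1, h 2⟩, fun h i => by fin_cases i; exacts [h.1, h.2.1, h.2.2]⟩

/-- The table `bigonNext` evaluates on each crossing, so after splitting over the two crossings both
sides agree definitionally. The analogous lemmas for the other pictures work in the same way. -/
theorem mem_col_bigon_parallel {k₀ k₁ : CrossingKind} {c : Fin 2 ⊕ (Fin 2 × Side) → X} :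
    c ∈ (bigon .parallel k₀ k₁).Col Q ↔
      CrossingRule Q k₀ (c (.inl 0)) (c (.inl 1)) (c (.inr (0, .left))) (c (.inr (0, .right))) ∧
      CrossingRule Q k₁ (c (.inr (0, .left))) (c (.inr (0, .right))) (c (.inr (1, .left)))
        (c (.inr (1, .right))) :=
  Fin.forall_fin_two

/-- Here `p` and `q` are the colors of the two inner semiarcs; every other semiarc has an endpoint
and its color is prescribed. -/
theorem hasColoring_bigon_parallel {k₀ k₁ : CrossingKind} {a b : Fin 2 → X} :
    (bigon .parallel k₀ k₁).HasColoring Q a b ↔ ∃ p q,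
      CrossingRule Q k₀ (a 0) (a 1) p q ∧
      CrossingRule Q k₁ p q (b 0) (b 1) := by
  constructor
  · rintro ⟨c, hc, ha, hb⟩
    obtain rfl : (fun i => c (.inl i)) = a := funext ha
    have hb := Fin.forall_fin_two.1 hb
    change c (.inr (1, .left)) = b 0 ∧ c (.inr (1, .right)) = b 1 at hb
    rw [← hb.1, ← hb.2]
    exact ⟨c (.inr (0, .left)), c (.inr (0, .right)), mem_col_bigon_parallel.1 hc⟩
  · rintro ⟨p, q, hc⟩
    refine ⟨colorOf a ![p, b 0] ![q, b 1], mem_col_bigon_parallel.2 hc, fun _ => rfl, ?_⟩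
    exact Fin.forall_fin_two.2 ⟨rfl, rfl⟩

/-- Only inner colors are not fixed by the endpoints, so the uniqueness of a coloring reduces to
that of `p` and `q`. -/
theorem boundaryDetermined_bigon_parallel {k₀ k₁ : CrossingKind}
    (H : ∀ {a b : Fin 2 → X} {p q p' q' : X},
      (CrossingRule Q k₀ (a 0) (a 1) p q ∧
      CrossingRule Q k₁ p q (b 0) (b 1)) →
      (CrossingRule Q k₀ (a 0) (a 1) p' q' ∧
      CrossingRule Q k₁ p' q' (b 0) (b 1)) → p = p' ∧ q = q') :
    BoundaryDetermined Q (bigon .parallel k₀ k₁) := by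
  intro c hc d hd h
  have hb := Fin.forall_fin_two.1 h.2
  change c (.inr (1, .left)) = d (.inr (1, .left)) ∧ c (.inr (1, .right)) = d (.inr (1,
    .right)) at hb
  obtain ⟨hb0, hb1⟩ := hb
  have hi : ∀ i, c (.inl i) = d (.inl i) := h.1
  have hc := mem_col_bigon_parallel.1 hc
  have hd := mem_col_bigon_parallel.1 hd
  simp only [hi, hb0, hb1] at hc
  obtain ⟨hp, hq⟩ := H (a := fun i => d (.inl i))
    (b := ![d (.inr (1, .left)), d (.inr (1, .right))]) hc hd
  exact funext_two hi ⟨hp, hq⟩ ⟨hb0, hb1⟩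

theorem mem_col_bigon_clockwise {k₀ k₁ : CrossingKind} {c : Fin 2 ⊕ (Fin 2 × Side) → X} :
    c ∈ (bigon .clockwise k₀ k₁).Col Q ↔
      CrossingRule Q k₀ (c (.inr (1, .left))) (c (.inl 0)) (c (.inr (0, .left)))
        (c (.inr (0, .right))) ∧
      CrossingRule Q k₁ (c (.inr (0, .left))) (c (.inl 1)) (c (.inr (1, .left)))
        (c (.inr (1, .right))) :=
  Fin.forall_fin_two

/-- The bigon is an oriented cycle: each inner color enters the rule that produces the other one, so
the inputs alone need not give them by substitution. -/
theorem hasColoring_bigon_clockwise {k₀ k₁ : CrossingKind} {a b : Fin 2 → X} :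
    (bigon .clockwise k₀ k₁).HasColoring Q a b ↔ ∃ p q,
      CrossingRule Q k₀ q (a 0) p (b 1) ∧
      CrossingRule Q k₁ p (a 1) q (b 0) := by
  constructor
  · rintro ⟨c, hc, ha, hb⟩
    obtain rfl : (fun i => c (.inl i)) = a := funext ha
    have hb := Fin.forall_fin_two.1 hb
    change c (.inr (1, .right)) = b 0 ∧ c (.inr (0, .right)) = b 1 at hb
    rw [← hb.1, ← hb.2]
    exact ⟨c (.inr (0, .left)), c (.inr (1, .left)), mem_col_bigon_clockwise.1 hc⟩
  · rintro ⟨p, q, hc⟩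
    refine ⟨colorOf a ![p, q] ![b 1, b 0], mem_col_bigon_clockwise.2 hc, fun _ => rfl, ?_⟩
    exact Fin.forall_fin_two.2 ⟨rfl, rfl⟩

theorem boundaryDetermined_bigon_clockwise {k₀ k₁ : CrossingKind}
    (H : ∀ {a b : Fin 2 → X} {p q p' q' : X},
      (CrossingRule Q k₀ q (a 0) p (b 1) ∧
      CrossingRule Q k₁ p (a 1) q (b 0)) →
      (CrossingRule Q k₀ q' (a 0) p' (b 1) ∧
      CrossingRule Q k₁ p' (a 1) q' (b 0)) → p = p' ∧ q = q') :
    BoundaryDetermined Q (bigon .clockwise k₀ k₁) := by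
  intro c hc d hd h
  have hb := Fin.forall_fin_two.1 h.2
  change c (.inr (1, .right)) = d (.inr (1, .right)) ∧ c (.inr (0, .right)) = d (.inr (0,
    .right)) at hb
  obtain ⟨hb0, hb1⟩ := hb
  have hi : ∀ i, c (.inl i) = d (.inl i) := h.1
  have hc := mem_col_bigon_clockwise.1 hc
  have hd := mem_col_bigon_clockwise.1 hd
  simp only [hi, hb0, hb1] at hc
  obtain ⟨hp, hq⟩ := H (a := fun i => d (.inl i))
    (b := ![d (.inr (1, .right)), d (.inr (0, .right))]) hc hd
  exact funext_two hi ⟨hp, hb1⟩ ⟨hq, hb0⟩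

theorem mem_col_bigon_counterclockwise {k₀ k₁ : CrossingKind} {c : Fin 2 ⊕ (Fin 2 × Side) → X} :
    c ∈ (bigon .counterclockwise k₀ k₁).Col Q ↔
      CrossingRule Q k₀ (c (.inl 0)) (c (.inr (1, .right))) (c (.inr (0, .left)))
        (c (.inr (0, .right))) ∧
      CrossingRule Q k₁ (c (.inl 1)) (c (.inr (0, .right))) (c (.inr (1, .left)))
        (c (.inr (1, .right))) :=
  Fin.forall_fin_two

theorem hasColoring_bigon_counterclockwise {k₀ k₁ : CrossingKind} {a b : Fin 2 → X} :
    (bigon .counterclockwise k₀ k₁).HasColoring Q a b ↔ ∃ p q,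
      CrossingRule Q k₀ (a 0) q (b 1) p ∧
      CrossingRule Q k₁ (a 1) p (b 0) q := by
  constructor
  · rintro ⟨c, hc, ha, hb⟩
    obtain rfl : (fun i => c (.inl i)) = a := funext ha
    have hb := Fin.forall_fin_two.1 hb
    change c (.inr (1, .left)) = b 0 ∧ c (.inr (0, .left)) = b 1 at hb
    rw [← hb.1, ← hb.2]
    exact ⟨c (.inr (0, .right)), c (.inr (1, .right)), mem_col_bigon_counterclockwise.1 hc⟩
  · rintro ⟨p, q, hc⟩
    refine ⟨colorOf a ![b 1, b 0] ![p, q], mem_col_bigon_counterclockwise.2 hc, fun _ => rfl, ?_⟩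
    exact Fin.forall_fin_two.2 ⟨rfl, rfl⟩

theorem boundaryDetermined_bigon_counterclockwise {k₀ k₁ : CrossingKind}
    (H : ∀ {a b : Fin 2 → X} {p q p' q' : X},
      (CrossingRule Q k₀ (a 0) q (b 1) p ∧
      CrossingRule Q k₁ (a 1) p (b 0) q) →
      (CrossingRule Q k₀ (a 0) q' (b 1) p' ∧
      CrossingRule Q k₁ (a 1) p' (b 0) q') → p = p' ∧ q = q') :
    BoundaryDetermined Q (bigon .counterclockwise k₀ k₁) := by
  intro c hc d hd h
  have hb := Fin.forall_fin_two.1 h.2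
  change c (.inr (1, .left)) = d (.inr (1, .left)) ∧ c (.inr (0, .left)) = d (.inr (0, .left)) at hb
  obtain ⟨hb0, hb1⟩ := hb
  have hi : ∀ i, c (.inl i) = d (.inl i) := h.1
  have hc := mem_col_bigon_counterclockwise.1 hc
  have hd := mem_col_bigon_counterclockwise.1 hd
  simp only [hi, hb0, hb1] at hc
  obtain ⟨hp, hq⟩ := H (a := fun i => d (.inl i))
    (b := ![d (.inr (1, .left)), d (.inr (0, .left))]) hc hd
  exact funext_two hi ⟨hb1, hp⟩ ⟨hb0, hq⟩

theorem mem_col_triangle_braided {h : Fin 3 → ℕ} {c : Fin 3 ⊕ (Fin 3 × Side) → X} :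
    c ∈ (triangle .braided h).Col Q ↔
      CrossingRule Q (triangleKind h .braided 0) (c (.inl 0)) (c (.inl 1))
        (c (.inr (0, .left))) (c (.inr (0, .right))) ∧
      CrossingRule Q (triangleKind h .braided 1) (c (.inr (0, .left))) (c (.inr (2, .left)))
        (c (.inr (1, .left))) (c (.inr (1, .right))) ∧
      CrossingRule Q (triangleKind h .braided 2) (c (.inr (0, .right))) (c (.inl 2))
        (c (.inr (2, .left))) (c (.inr (2, .right))) :=
  forall_fin_three

/-- Each strand has exactly one inner semiarc, which accounts for the three unknowns. -/
theorem hasColoring_triangle_braided {h : Fin 3 → ℕ} {a b : Fin 3 → X} :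
    (triangle .braided h).HasColoring Q a b ↔ ∃ p q r,
      CrossingRule Q (triangleKind h .braided 0) (a 0) (a 1) p q ∧
      CrossingRule Q (triangleKind h .braided 1) p r (b 2) (b 1) ∧
      CrossingRule Q (triangleKind h .braided 2) q (a 2) r (b 0) := by
  constructor
  · rintro ⟨c, hc, ha, hb⟩
    obtain rfl : (fun i => c (.inl i)) = a := funext ha
    have hb := forall_fin_three.1 hb
    change c (.inr (2, .right)) = b 0 ∧ c (.inr (1, .right)) = b 1 ∧ c (.inr (1, .left)) = b 2 at hb
    rw [← hb.1, ← hb.2.1, ← hb.2.2]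
    exact ⟨c (.inr (0, .left)), c (.inr (0, .right)), c (.inr (2, .left)),
      mem_col_triangle_braided.1 hc⟩
  · rintro ⟨p, q, r, hc⟩
    refine ⟨colorOf a ![p, b 2, r] ![q, b 1, b 0], mem_col_triangle_braided.2 hc, fun _ => rfl, ?_⟩
    exact forall_fin_three.2 ⟨rfl, rfl, rfl⟩

theorem boundaryDetermined_triangle_braided {h : Fin 3 → ℕ}
    (H : ∀ {a b : Fin 3 → X} {p q r p' q' r' : X},
      (CrossingRule Q (triangleKind h .braided 0) (a 0) (a 1) p q ∧
      CrossingRule Q (triangleKind h .braided 1) p r (b 2) (b 1) ∧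
      CrossingRule Q (triangleKind h .braided 2) q (a 2) r (b 0)) →
      (CrossingRule Q (triangleKind h .braided 0) (a 0) (a 1) p' q' ∧
      CrossingRule Q (triangleKind h .braided 1) p' r' (b 2) (b 1) ∧
      CrossingRule Q (triangleKind h .braided 2) q' (a 2) r' (b 0)) → p = p' ∧ q = q' ∧ r = r') :
    BoundaryDetermined Q (triangle .braided h) := by
  intro c hc d hd h
  have hb := forall_fin_three.1 h.2
  change c (.inr (2, .right)) = d (.inr (2, .right)) ∧ c (.inr (1, .right)) = d (.inr (1,
    .right)) ∧ c (.inr (1, .left)) = d (.inr (1, .left)) at hb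
  obtain ⟨hb0, hb1, hb2⟩ := hb
  have hi : ∀ i, c (.inl i) = d (.inl i) := h.1
  have hc := mem_col_triangle_braided.1 hc
  have hd := mem_col_triangle_braided.1 hd
  simp only [hi, hb0, hb1, hb2] at hc
  obtain ⟨hp, hq, hr⟩ := H (a := fun i => d (.inl i))
    (b := ![d (.inr (2, .right)), d (.inr (1, .right)), d (.inr (1, .left))]) hc hd
  exact funext_three hi ⟨hp, hq⟩ ⟨hb2, hb1⟩ ⟨hr, hb0⟩

theorem mem_col_triangle'_braided {h : Fin 3 → ℕ} {c : Fin 3 ⊕ (Fin 3 × Side) → X} :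
    c ∈ (triangle' .braided h).Col Q ↔
      CrossingRule Q (triangleKind h .braided 0) (c (.inr (2, .right))) (c (.inr (1, .right)))
        (c (.inr (0, .left))) (c (.inr (0, .right))) ∧
      CrossingRule Q (triangleKind h .braided 1) (c (.inl 1)) (c (.inl 2))
        (c (.inr (1, .left))) (c (.inr (1, .right))) ∧
      CrossingRule Q (triangleKind h .braided 2) (c (.inl 0)) (c (.inr (1, .left)))
        (c (.inr (2, .left))) (c (.inr (2, .right))) :=
  forall_fin_three

theorem hasColoring_triangle'_braided {h : Fin 3 → ℕ} {a b : Fin 3 → X} :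
    (triangle' .braided h).HasColoring Q a b ↔ ∃ p q r,
      CrossingRule Q (triangleKind h .braided 0) r q (b 1) (b 0) ∧
      CrossingRule Q (triangleKind h .braided 1) (a 1) (a 2) p q ∧
      CrossingRule Q (triangleKind h .braided 2) (a 0) p (b 2) r := by
  constructor
  · rintro ⟨c, hc, ha, hb⟩
    obtain rfl : (fun i => c (.inl i)) = a := funext ha
    have hb := forall_fin_three.1 hb
    change c (.inr (0, .right)) = b 0 ∧ c (.inr (0, .left)) = b 1 ∧ c (.inr (2, .left)) = b 2 at hb
    rw [← hb.1, ← hb.2.1, ← hb.2.2]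
    exact ⟨c (.inr (1, .left)), c (.inr (1, .right)), c (.inr (2, .right)),
      mem_col_triangle'_braided.1 hc⟩
  · rintro ⟨p, q, r, hc⟩
    refine ⟨colorOf a ![b 1, p, b 2] ![b 0, q, r], mem_col_triangle'_braided.2 hc, fun _ => rfl, ?_⟩
    exact forall_fin_three.2 ⟨rfl, rfl, rfl⟩

theorem boundaryDetermined_triangle'_braided {h : Fin 3 → ℕ}
    (H : ∀ {a b : Fin 3 → X} {p q r p' q' r' : X},
      (CrossingRule Q (triangleKind h .braided 0) r q (b 1) (b 0) ∧
      CrossingRule Q (triangleKind h .braided 1) (a 1) (a 2) p q ∧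
      CrossingRule Q (triangleKind h .braided 2) (a 0) p (b 2) r) →
      (CrossingRule Q (triangleKind h .braided 0) r' q' (b 1) (b 0) ∧
      CrossingRule Q (triangleKind h .braided 1) (a 1) (a 2) p' q' ∧
      CrossingRule Q (triangleKind h .braided 2) (a 0) p' (b 2) r') → p = p' ∧ q = q' ∧ r = r') :
    BoundaryDetermined Q (triangle' .braided h) := by
  intro c hc d hd h
  have hb := forall_fin_three.1 h.2
  change c (.inr (0, .right)) = d (.inr (0, .right)) ∧ c (.inr (0, .left)) = d (.inr (0, .left)) ∧
    c (.inr (2, .left)) = d (.inr (2, .left)) at hb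
  obtain ⟨hb0, hb1, hb2⟩ := hb
  have hi : ∀ i, c (.inl i) = d (.inl i) := h.1
  have hc := mem_col_triangle'_braided.1 hc
  have hd := mem_col_triangle'_braided.1 hd
  simp only [hi, hb0, hb1, hb2] at hc
  obtain ⟨hp, hq, hr⟩ := H (a := fun i => d (.inl i))
    (b := ![d (.inr (0, .right)), d (.inr (0, .left)), d (.inr (2, .left))]) hc hd
  exact funext_three hi ⟨hb1, hb0⟩ ⟨hp, hq⟩ ⟨hb2, hr⟩

theorem mem_col_triangle_alternating {h : Fin 3 → ℕ} {c : Fin 3 ⊕ (Fin 3 × Side) → X} :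
    c ∈ (triangle .alternating h).Col Q ↔
      CrossingRule Q (triangleKind h .alternating 0) (c (.inl 1)) (c (.inr (2, .right)))
        (c (.inr (0, .left))) (c (.inr (0, .right))) ∧
      CrossingRule Q (triangleKind h .alternating 1) (c (.inl 2)) (c (.inr (0, .right)))
        (c (.inr (1, .left))) (c (.inr (1, .right))) ∧
      CrossingRule Q (triangleKind h .alternating 2) (c (.inl 0)) (c (.inr (1, .right)))
        (c (.inr (2, .left))) (c (.inr (2, .right))) :=
  forall_fin_three

/-- The inner semiarcs form an oriented cycle, so the system is cyclic in `p`, `q`, `r`. -/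
theorem hasColoring_triangle_alternating {h : Fin 3 → ℕ} {a b : Fin 3 → X} :
    (triangle .alternating h).HasColoring Q a b ↔ ∃ p q r,
      CrossingRule Q (triangleKind h .alternating 0) (a 1) r (b 0) p ∧
      CrossingRule Q (triangleKind h .alternating 1) (a 2) p (b 1) q ∧
      CrossingRule Q (triangleKind h .alternating 2) (a 0) q (b 2) r := by
  constructor
  · rintro ⟨c, hc, ha, hb⟩
    obtain rfl : (fun i => c (.inl i)) = a := funext ha
    have hb := forall_fin_three.1 hb
    change c (.inr (0, .left)) = b 0 ∧ c (.inr (1, .left)) = b 1 ∧ c (.inr (2, .left)) = b 2 at hb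
    rw [← hb.1, ← hb.2.1, ← hb.2.2]
    exact ⟨c (.inr (0, .right)), c (.inr (1, .right)), c (.inr (2, .right)),
      mem_col_triangle_alternating.1 hc⟩
  · rintro ⟨p, q, r, hc⟩
    refine ⟨colorOf a ![b 0, b 1, b 2] ![p, q, r], mem_col_triangle_alternating.2 hc, fun _ => rfl,
      ?_⟩
    exact forall_fin_three.2 ⟨rfl, rfl, rfl⟩

theorem boundaryDetermined_triangle_alternating {h : Fin 3 → ℕ}
    (H : ∀ {a b : Fin 3 → X} {p q r p' q' r' : X},
      (CrossingRule Q (triangleKind h .alternating 0) (a 1) r (b 0) p ∧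
      CrossingRule Q (triangleKind h .alternating 1) (a 2) p (b 1) q ∧
      CrossingRule Q (triangleKind h .alternating 2) (a 0) q (b 2) r) →
      (CrossingRule Q (triangleKind h .alternating 0) (a 1) r' (b 0) p' ∧
      CrossingRule Q (triangleKind h .alternating 1) (a 2) p' (b 1) q' ∧
      CrossingRule Q (triangleKind h .alternating 2) (a 0) q' (b 2) r') → p = p' ∧ q = q' ∧ r = r')
        :
    BoundaryDetermined Q (triangle .alternating h) := by
  intro c hc d hd h
  have hb := forall_fin_three.1 h.2
  change c (.inr (0, .left)) = d (.inr (0, .left)) ∧ c (.inr (1, .left)) = d (.inr (1, .left)) ∧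
    c (.inr (2, .left)) = d (.inr (2, .left)) at hb
  obtain ⟨hb0, hb1, hb2⟩ := hb
  have hi : ∀ i, c (.inl i) = d (.inl i) := h.1
  have hc := mem_col_triangle_alternating.1 hc
  have hd := mem_col_triangle_alternating.1 hd
  simp only [hi, hb0, hb1, hb2] at hc
  obtain ⟨hp, hq, hr⟩ := H (a := fun i => d (.inl i))
    (b := ![d (.inr (0, .left)), d (.inr (1, .left)), d (.inr (2, .left))]) hc hd
  exact funext_three hi ⟨hb0, hp⟩ ⟨hb1, hq⟩ ⟨hb2, hr⟩

theorem mem_col_triangle'_alternating {h : Fin 3 → ℕ} {c : Fin 3 ⊕ (Fin 3 × Side) → X} :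
    c ∈ (triangle' .alternating h).Col Q ↔
      CrossingRule Q (triangleKind h .alternating 0) (c (.inr (1, .left))) (c (.inl 0))
        (c (.inr (0, .left))) (c (.inr (0, .right))) ∧
      CrossingRule Q (triangleKind h .alternating 1) (c (.inr (2, .left))) (c (.inl 1))
        (c (.inr (1, .left))) (c (.inr (1, .right))) ∧
      CrossingRule Q (triangleKind h .alternating 2) (c (.inr (0, .left))) (c (.inl 2))
        (c (.inr (2, .left))) (c (.inr (2, .right))) :=
  forall_fin_three

theorem hasColoring_triangle'_alternating {h : Fin 3 → ℕ} {a b : Fin 3 → X} :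
    (triangle' .alternating h).HasColoring Q a b ↔ ∃ p q r,
      CrossingRule Q (triangleKind h .alternating 0) q (a 0) p (b 1) ∧
      CrossingRule Q (triangleKind h .alternating 1) r (a 1) q (b 2) ∧
      CrossingRule Q (triangleKind h .alternating 2) p (a 2) r (b 0) := by
  constructor
  · rintro ⟨c, hc, ha, hb⟩
    obtain rfl : (fun i => c (.inl i)) = a := funext ha
    have hb := forall_fin_three.1 hb
    change c (.inr (2, .right)) = b 0 ∧ c (.inr (0, .right)) = b 1 ∧ c (.inr (1,
      .right)) = b 2 at hb
    rw [← hb.1, ← hb.2.1, ← hb.2.2]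
    exact ⟨c (.inr (0, .left)), c (.inr (1, .left)), c (.inr (2, .left)),
      mem_col_triangle'_alternating.1 hc⟩
  · rintro ⟨p, q, r, hc⟩
    refine ⟨colorOf a ![p, q, r] ![b 1, b 2, b 0], mem_col_triangle'_alternating.2 hc,
      fun _ => rfl, ?_⟩
    exact forall_fin_three.2 ⟨rfl, rfl, rfl⟩

theorem boundaryDetermined_triangle'_alternating {h : Fin 3 → ℕ}
    (H : ∀ {a b : Fin 3 → X} {p q r p' q' r' : X},
      (CrossingRule Q (triangleKind h .alternating 0) q (a 0) p (b 1) ∧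
      CrossingRule Q (triangleKind h .alternating 1) r (a 1) q (b 2) ∧
      CrossingRule Q (triangleKind h .alternating 2) p (a 2) r (b 0)) →
      (CrossingRule Q (triangleKind h .alternating 0) q' (a 0) p' (b 1) ∧
      CrossingRule Q (triangleKind h .alternating 1) r' (a 1) q' (b 2) ∧
      CrossingRule Q (triangleKind h .alternating 2) p' (a 2) r' (b 0)) → p = p' ∧ q = q' ∧ r = r')
        :
    BoundaryDetermined Q (triangle' .alternating h) := by
  intro c hc d hd h
  have hb := forall_fin_three.1 h.2
  change c (.inr (2, .right)) = d (.inr (2, .right)) ∧ c (.inr (0, .right)) = d (.inr (0,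
    .right)) ∧ c (.inr (1, .right)) = d (.inr (1, .right)) at hb
  obtain ⟨hb0, hb1, hb2⟩ := hb
  have hi : ∀ i, c (.inl i) = d (.inl i) := h.1
  have hc := mem_col_triangle'_alternating.1 hc
  have hd := mem_col_triangle'_alternating.1 hd
  simp only [hi, hb0, hb1, hb2] at hc
  obtain ⟨hp, hq, hr⟩ := H (a := fun i => d (.inl i))
    (b := ![d (.inr (2, .right)), d (.inr (0, .right)), d (.inr (1, .right))]) hc hd
  exact funext_three hi ⟨hp, hb1⟩ ⟨hq, hb2⟩ ⟨hr, hb0⟩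

end LocalMoves

/-! ### Color equivalence of the two sides of each move -/

section ColorEquivalence

open Tangle

variable {X : Type*} [Quandle X] {Q : OrientedSingquandle X}

attribute [local grind =] qop_qinv qinv_qop qop_self qinv_self qop_qop qinv_qop_distrib
  qop_qinv_distrib qinv_qinv_distrib

theorem colorEquivalent_bigon_omega2 (σ : BigonShape) (ε : Bool) :
    ColorEquivalent Q (strands 2) (bigon σ (.ofSign ε) (.ofSign !ε)) := by
  cases σ
  · refine .of_hasColoring_iff (boundaryDetermined_strands 2)
      (boundaryDetermined_bigon_parallel fun {a b p q p' q'} h h' => ?_) fun a b => ?_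
    · cases ε <;> simp only [CrossingRule, CrossingKind.ofSign, Bool.not_true,
        Bool.not_false] at * <;> grind
    · rw [hasColoring_strands, hasColoring_bigon_parallel, funext_iff, Fin.forall_fin_two]
      cases ε <;> simp only [CrossingRule, CrossingKind.ofSign, Bool.not_true,
        Bool.not_false] <;> grind
  · refine .of_hasColoring_iff (boundaryDetermined_strands 2)
      (boundaryDetermined_bigon_clockwise fun {a b p q p' q'} h h' => ?_) fun a b => ?_
    · cases ε <;> simp only [CrossingRule, CrossingKind.ofSign, Bool.not_true,
        Bool.not_false] at * <;> grind
    · rw [hasColoring_strands, hasColoring_bigon_clockwise, funext_iff, Fin.forall_fin_two]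
      cases ε <;> simp only [CrossingRule, CrossingKind.ofSign, Bool.not_true,
        Bool.not_false] <;> grind
  · refine .of_hasColoring_iff (boundaryDetermined_strands 2)
      (boundaryDetermined_bigon_counterclockwise fun {a b p q p' q'} h h' => ?_) fun a b => ?_
    · cases ε <;> simp only [CrossingRule, CrossingKind.ofSign, Bool.not_true,
        Bool.not_false] at * <;> grind
    · rw [hasColoring_strands, hasColoring_bigon_counterclockwise, funext_iff, Fin.forall_fin_two]
      cases ε <;> simp only [CrossingRule, CrossingKind.ofSign, Bool.not_true,
        Bool.not_false] <;> grind

/-- For a clockwise bigon with a negative crossing the inner color `u` occurs on both sides of its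
own equation and cannot be eliminated. The statement exchanges `(a, u)` with `(b, v)`, so applying
it twice gives both directions of the move. -/
theorem OrientedSingquandle.antiparallel_negative (Q : OrientedSingquandle X) {a b u v : X}
    (hu : u = Q.R₁ (b ⊛ u) a) (hv : v = Q.R₂ (b ⊛ u) a) :
    v = Q.R₁ (a ⊛ v) b ∧ u = Q.R₂ (a ⊛ v) b := by
  obtain ⟨x, rfl⟩ : ∃ x, b = x ∗ u := ⟨b ⊛ u, (qinv_qop b u).symm⟩
  rw [qop_qinv] at hu hv
  have hb : (x ∗ u) ∗ v = x ∗ a := by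
    -- The middle argument is chosen so that the left side becomes `((x ∗ u) ⊛ u) ∗ x = x`. The
    -- resulting identity puts the second argument after a slide into the form `x ∗ a` required by
    -- the twist axioms.
    have := Q.pass_under x (x ∗ u) a
    rwa [← hu, ← hv, qop_qinv, qop_self, eq_qinv_iff, eq_comm] at this
  constructor
  · apply qop_right_cancel (z := v)
    rw [Q.r₁_slide, hb, ← Q.twist₁, ← hv, qop_self]
  · rw [Q.r₂_slide, hb, ← Q.twist₂, ← hu, ← hv, qop_qinv]

/-- The counterpart for a counterclockwise bigon with a positive crossing, with the same symmetry
between `(a, u)` and `(b, v)`. -/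
theorem OrientedSingquandle.antiparallel_positive (Q : OrientedSingquandle X) {a b u v : X}
    (hu : u = Q.R₂ a (b ∗ u)) (hv : v = Q.R₁ a (b ∗ u)) :
    v = Q.R₂ b (a ∗ v) ∧ u = Q.R₁ b (a ∗ v) := by
  obtain ⟨z, rfl⟩ : ∃ z, b = z ⊛ u := ⟨b ∗ u, (qop_qinv b u).symm⟩
  rw [qinv_qop] at hu hv
  have ha : (a ∗ v) ∗ u = a ∗ z := by
    -- Again the left side collapses, now to `a ∗ a = a`, since `v = Q.R₁ a z`.
    have := Q.pass_under a (a ∗ v) z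
    rwa [← hu, ← hv, qop_qinv, qop_self, eq_qinv_iff, eq_comm] at this
  constructor
  · rw [Q.r₂_slide, ha, ← Q.twist₂, ← hu, ← hv, qop_qinv]
  · apply qop_right_cancel (z := u)
    rw [Q.r₁_slide, ha, ← Q.twist₁, ← hu, qop_self]

/-- Parallel strands are governed by the twist axioms directly. For a cyclic bigon, one sign of the
classical crossing lets all colors be computed from the inputs, and the other sign leads to the
implicit equations of the two antiparallel lemmas. -/
theorem colorEquivalent_bigon_omega5 (σ : BigonShape) (ε : Bool) :
    ColorEquivalent Q (bigon σ .singular (.ofSign ε)) (bigon σ (.ofSign ε) .singular) := by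
  have h₁ := Q.r₁_slide
  have h₂ := Q.r₂_slide
  have h₃ := Q.pass_under
  have h₄ := Q.twist₁
  have h₅ := Q.twist₂
  cases σ
  · refine .of_hasColoring_iff
      (boundaryDetermined_bigon_parallel fun {a b p q p' q'} h h' => ?_)
      (boundaryDetermined_bigon_parallel fun {a b p q p' q'} h h' => ?_) fun a b => ?_
    · cases ε <;> simp only [CrossingRule, CrossingKind.ofSign] at * <;> grind
    · cases ε <;> simp only [CrossingRule, CrossingKind.ofSign] at * <;> grind
    · rw [hasColoring_bigon_parallel, hasColoring_bigon_parallel]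
      cases ε <;> simp only [CrossingRule, CrossingKind.ofSign] <;> grind
  · refine .of_hasColoring_iff
      (boundaryDetermined_bigon_clockwise fun {a b p q p' q'} h h' => ?_)
      (boundaryDetermined_bigon_clockwise fun {a b p q p' q'} h h' => ?_) fun a b => ?_
    · cases ε <;> simp only [CrossingRule, CrossingKind.ofSign] at * <;> grind
    · cases ε <;> simp only [CrossingRule, CrossingKind.ofSign] at * <;> grind
    · rw [hasColoring_bigon_clockwise, hasColoring_bigon_clockwise]
      cases ε <;> simp only [CrossingRule, CrossingKind.ofSign]
      · have h := @OrientedSingquandle.antiparallel_negative X _ Q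
        constructor
        · rintro ⟨p, q, ⟨hp, hb⟩, rfl, rfl⟩
          obtain ⟨h₁, h₂⟩ := h hp hb
          exact ⟨_, _, ⟨rfl, rfl⟩, h₁, h₂⟩
        · rintro ⟨p, q, ⟨rfl, rfl⟩, hq, hb⟩
          obtain ⟨h₁, h₂⟩ := h hq hb
          exact ⟨_, _, ⟨h₁, h₂⟩, rfl, rfl⟩
      -- The identity needed is `R₁ x z ∗ x = R₂ z x`: the case `y = x` of `r₁_slide` followed by
      -- `twist₁`.
      · grind
  · refine .of_hasColoring_iff
      (boundaryDetermined_bigon_counterclockwise fun {a b p q p' q'} h h' => ?_)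
      (boundaryDetermined_bigon_counterclockwise fun {a b p q p' q'} h h' => ?_) fun a b => ?_
    · cases ε <;> simp only [CrossingRule, CrossingKind.ofSign] at * <;> grind
    · cases ε <;> simp only [CrossingRule, CrossingKind.ofSign] at * <;> grind
    · rw [hasColoring_bigon_counterclockwise, hasColoring_bigon_counterclockwise]
      cases ε <;> simp only [CrossingRule, CrossingKind.ofSign]
      -- The same identity `R₁ x z ∗ x = R₂ z x` serves here, solved for `R₁ x z`.
      · grind
      · have h := @OrientedSingquandle.antiparallel_positive X _ Q
        constructor
        · rintro ⟨p, q, ⟨hb, hp⟩, rfl, rfl⟩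
          obtain ⟨h₁, h₂⟩ := h hp hb
          exact ⟨_, _, ⟨rfl, rfl⟩, h₂, h₁⟩
        · rintro ⟨p, q, ⟨rfl, rfl⟩, hb, hq⟩
          obtain ⟨h₁, h₂⟩ := h hq hb
          exact ⟨_, _, ⟨h₂, h₁⟩, rfl, rfl⟩

/-- This and the next two lemmas solve the Ω4 axioms for the inverse operations, to serve the
triangles whose strands or signs are arranged differently from the axioms. -/
theorem OrientedSingquandle.r₁_slide_inv (Q : OrientedSingquandle X) (x y z : X) :
    Q.R₁ (x ∗ y) z ⊛ y = Q.R₁ x (z ⊛ y) := by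
  have h := Q.r₁_slide (x ∗ y) y (z ⊛ y)
  rw [qop_qinv, qinv_qop] at h
  rw [← h, qop_qinv]

theorem OrientedSingquandle.r₂_slide_inv (Q : OrientedSingquandle X) (x y z : X) :
    Q.R₂ (x ∗ y) z = Q.R₂ x (z ⊛ y) ∗ y := by
  have h := Q.r₂_slide (x ∗ y) y (z ⊛ y)
  rw [qop_qinv, qinv_qop] at h
  rw [h, qinv_qop]

theorem OrientedSingquandle.pass_under_inv (Q : OrientedSingquandle X) (x y z : X) :
    (y ⊛ x) ∗ Q.R₁ x z = (y ∗ z) ⊛ Q.R₂ x z := by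
  -- With this middle argument the left side of `pass_under` cancels to `y`.
  have h := Q.pass_under x ((y ⊛ x) ∗ Q.R₁ x z) z
  rw [qop_qinv, qinv_qop, eq_qinv_iff] at h
  rw [eq_qinv_iff, h]

/-- Three heights have thirteen weak orderings; without the total tie, six strict ones (Ω3) and six
with one tie (Ω4) remain. Cyclic over-under patterns do not come from heights. -/
theorem triangleKind_braided_cases {h : Fin 3 → ℕ} (hne : ¬(h 0 = h 1 ∧ h 1 = h 2)) :
    ∃ k₀ k₁ k₂, triangleKind h .braided 0 = k₀ ∧ triangleKind h .braided 1 = k₁ ∧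
      triangleKind h .braided 2 = k₂ ∧ (k₀, k₁, k₂) ∈ ([
        (.singular, .positive, .positive),
        (.positive, .negative, .singular),
        (.positive, .singular, .positive),
        (.positive, .positive, .positive),
        (.positive, .negative, .positive),
        (.negative, .singular, .negative),
        (.negative, .positive, .singular),
        (.negative, .positive, .positive),
        (.singular, .negative, .negative),
        (.positive, .negative, .negative),
        (.negative, .positive, .negative),
        (.negative, .negative, .negative)] :
        List (CrossingKind × CrossingKind × CrossingKind)) := by
  refine ⟨_, _, _, rfl, rfl, rfl, ?_⟩
  simp only [triangleKind, Matrix.cons_val, CrossingKind.ofHeights]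
  split_ifs <;> first | (exfalso; omega) | simp

/-- Uniqueness: a strand that passes over another keeps an endpoint color on its inner semiarc. A
strand that never does is lowest and lies under a strictly higher one, whose colors are already
known. This needs the heights not to be all equal. Equality of the boundary conditions is
self-distributivity for distinct heights and an Ω4 axiom, possibly in inverted form, for a tie. -/
theorem colorEquivalent_triangle_braided {h : Fin 3 → ℕ} (hne : ¬(h 0 = h 1 ∧ h 1 = h 2)) :
    ColorEquivalent Q (triangle .braided h) (triangle' .braided h) := by
  obtain ⟨k₀, k₁, k₂, e₀, e₁, e₂, hk⟩ := triangleKind_braided_cases hne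
  have h₁ := Q.r₁_slide
  have h₂ := Q.r₂_slide
  have h₃ := Q.pass_under
  have h₄ := Q.r₁_slide_inv
  have h₅ := Q.r₂_slide_inv
  have h₆ := Q.pass_under_inv
  simp only [List.mem_cons, List.not_mem_nil, or_false, Prod.mk.injEq] at hk
  refine .of_hasColoring_iff
    (boundaryDetermined_triangle_braided fun {a b p q r p' q' r'} h h' => ?_)
    (boundaryDetermined_triangle'_braided fun {a b p q r p' q' r'} h h' => ?_) fun a b => ?_
  · rw [e₀, e₁, e₂] at h h'
    -- Uniqueness of the inner colors uses quandle laws only; `R₁` and `R₂` may be arbitrary maps.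
    clear h₁ h₂ h₃ h₄ h₅ h₆
    rcases hk with hk | hk | hk | hk | hk | hk | hk | hk | hk | hk | hk | hk <;>
      obtain ⟨rfl, rfl, rfl⟩ := hk <;> simp only [CrossingRule] at h h' <;>
      clear e₀ e₁ e₂ hne <;> grind
  · rw [e₀, e₁, e₂] at h h'
    clear h₁ h₂ h₃ h₄ h₅ h₆
    rcases hk with hk | hk | hk | hk | hk | hk | hk | hk | hk | hk | hk | hk <;>
      obtain ⟨rfl, rfl, rfl⟩ := hk <;> simp only [CrossingRule] at h h' <;>
      clear e₀ e₁ e₂ hne <;> grind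
  · rw [hasColoring_triangle_braided, hasColoring_triangle'_braided, e₀, e₁, e₂]
    rcases hk with hk | hk | hk | hk | hk | hk | hk | hk | hk | hk | hk | hk <;>
      obtain ⟨rfl, rfl, rfl⟩ := hk <;> simp only [CrossingRule] <;> clear e₀ e₁ e₂ hne <;> grind

theorem triangleKind_alternating_cases {h : Fin 3 → ℕ} (hne : ¬(h 0 = h 1 ∧ h 1 = h 2)) :
    ∃ k₀ k₁ k₂, triangleKind h .alternating 0 = k₀ ∧ triangleKind h .alternating 1 = k₁ ∧
      triangleKind h .alternating 2 = k₂ ∧ (k₀, k₁, k₂) ∈ ([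
        (.singular, .negative, .positive),
        (.negative, .positive, .singular),
        (.negative, .singular, .positive),
        (.negative, .negative, .positive),
        (.negative, .positive, .positive),
        (.positive, .singular, .negative),
        (.positive, .negative, .singular),
        (.positive, .negative, .positive),
        (.singular, .positive, .negative),
        (.negative, .positive, .negative),
        (.positive, .negative, .negative),
        (.positive, .positive, .negative)] :
        List (CrossingKind × CrossingKind × CrossingKind)) := by
  refine ⟨_, _, _, rfl, rfl, rfl, ?_⟩
  simp only [triangleKind, Matrix.cons_val, CrossingKind.ofHeights]
  split_ifs <;> first | (exfalso; omega) | simp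

/-- The uniqueness argument is that of the braided case: a strand that is over somewhere breaks the
cycle of equations. For a tie, comparing the endpoint colors gives literally `r₁_slide` and
`r₂_slide` (third strand over) or `pass_under` (third strand under), up to rotation of the picture.
-/
theorem colorEquivalent_triangle_alternating {h : Fin 3 → ℕ} (hne : ¬(h 0 = h 1 ∧ h 1 = h 2)) :
    ColorEquivalent Q (triangle .alternating h) (triangle' .alternating h) := by
  obtain ⟨k₀, k₁, k₂, e₀, e₁, e₂, hk⟩ := triangleKind_alternating_cases hne
  have h₁ := Q.r₁_slide
  have h₂ := Q.r₂_slide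
  have h₃ := Q.pass_under
  have h₄ := Q.r₁_slide_inv
  have h₅ := Q.r₂_slide_inv
  have h₆ := Q.pass_under_inv
  simp only [List.mem_cons, List.not_mem_nil, or_false, Prod.mk.injEq] at hk
  refine .of_hasColoring_iff
    (boundaryDetermined_triangle_alternating fun {a b p q r p' q' r'} h h' => ?_)
    (boundaryDetermined_triangle'_alternating fun {a b p q r p' q' r'} h h' => ?_) fun a b => ?_
  · rw [e₀, e₁, e₂] at h h'
    clear h₁ h₂ h₃ h₄ h₅ h₆
    rcases hk with hk | hk | hk | hk | hk | hk | hk | hk | hk | hk | hk | hk <;>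
      obtain ⟨rfl, rfl, rfl⟩ := hk <;> simp only [CrossingRule] at h h' <;>
      clear e₀ e₁ e₂ hne <;> grind
  · rw [e₀, e₁, e₂] at h h'
    clear h₁ h₂ h₃ h₄ h₅ h₆
    rcases hk with hk | hk | hk | hk | hk | hk | hk | hk | hk | hk | hk | hk <;>
      obtain ⟨rfl, rfl, rfl⟩ := hk <;> simp only [CrossingRule] at h h' <;>
      clear e₀ e₁ e₂ hne <;> grind
  · rw [hasColoring_triangle_alternating, hasColoring_triangle'_alternating, e₀, e₁, e₂]
    rcases hk with hk | hk | hk | hk | hk | hk | hk | hk | hk | hk | hk | hk <;>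
      obtain ⟨rfl, rfl, rfl⟩ := hk <;> simp only [CrossingRule] <;> clear e₀ e₁ e₂ hne <;> grind

theorem colorEquivalent_triangle (σ : TriangleShape) {h : Fin 3 → ℕ}
    (hne : ¬(h 0 = h 1 ∧ h 1 = h 2)) : ColorEquivalent Q (triangle σ h) (triangle' σ h) := by
  cases σ
  · exact colorEquivalent_triangle_braided hne
  · exact colorEquivalent_triangle_alternating hne

end ColorEquivalence

/-! ### From local moves to equivalent diagrams -/

theorem LocalMove.colorEquivalent {X : Type*} [Quandle X] (Q : OrientedSingquandle X) {n : ℕ}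
    {T T' : LocalTangle n} (h : LocalMove T T') : Tangle.ColorEquivalent Q T T' := by
  cases h with
  | omega1 s ε => exact colorEquivalent_curl s ε
  | omega2 σ ε => exact colorEquivalent_bigon_omega2 σ ε
  | omega3 σ h hh => exact colorEquivalent_triangle σ fun h' => by simpa using hh h'.1
  | omega4 σ h i j k hij heq hne =>
    refine colorEquivalent_triangle σ fun h' => hne ?_
    have h0 : ∀ l, h l = h 0 := forall_fin_three.2 ⟨rfl, h'.1.symm, (h'.1.trans h'.2).symm⟩
    rw [h0 k, h0 i]
  | omega5 σ ε => exact colorEquivalent_bigon_omega5 σ ε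

theorem Equivalent.nonempty_col_equiv {X : Type*} [Quandle X] (Q : OrientedSingquandle X)
    {D D' : Diagram} (h : Equivalent D D') : Nonempty (D.Col Q ≃ D'.Col Q) := by
  induction h with
  | rel D D' h =>
    exact h.elim (fun ⟨e⟩ => e.nonempty_col_equiv Q) fun ⟨m⟩ =>
      (m.glue.exists_equiv m.glue' (m.localMove.colorEquivalent Q)).nonempty
  | refl D => exact ⟨Equiv.refl _⟩
  | symm _ _ _ ih => exact ih.map Equiv.symm
  | trans _ _ _ _ _ ih ih' => exact ih.elim fun e => ih'.map e.trans

end SingularLink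

theorem mainTheorem2 {X : Type*} [Quandle X] (Q : SingularLink.OrientedSingquandle X) :
    (∀ (D D' : SingularLink.Diagram) (m : SingularLink.Move D D'),
      ∃ Φ : D.Col Q ≃ D'.Col Q, ∀ (c : D.Col Q) (a : m.S.Arc),
        (Φ c).1 (m.glue'.arc (.inr a)) = c.1 (m.glue.arc (.inr a))) ∧
    (∀ D D' : SingularLink.Diagram, SingularLink.Equivalent D D' →
      Nonempty (D.Col Q ≃ D'.Col Q)) :=
  ⟨fun _ _ m => m.glue.exists_equiv m.glue' (m.localMove.colorEquivalent Q),
    fun _ _ h => h.nonempty_col_equiv Q⟩
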